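/- Let $\Delta$ be a reduced irreducible crystallographic root system (for instance that of a simple complex Lie algebra) having two root lengths and spanning a Euclidean space $V$ whose inner product $(\ ,\ )$ is invariant under the Weyl group. Fix a set $\Pi$ of simple roots, let $\Delta^+$ be the set of positive roots, $\Delta^+_l\subset\Delta^+$ the set of long positive roots, $\theta$ the highest root and $\theta_s$ the short dominant root. An Abelian ideal is a subset $I\subset\Delta^+$ such that $\mu+\nu\notin\Delta$ for all $\mu,\nu\in I$, and such that $\gamma+\nu\in I$ whenever $\gamma\in I$, $\nu\in\Delta^+$ and $\gamma+\nu\in\Delta$. It is called long if $I\subset\Delta^+_l$. Let $\widehat V=V\oplus\mathbb R\delta\oplus\mathbb R\lambda$ with the form extending $(\ ,\ )$ by $(\delta,V)=(\lambda,V)=(\delta,\delta)=(\lambda,\lambda)=0$ and $(\delta,\lambda)=1$. Let $\widehat\Delta^+=\Delta^+\cup\{\mu+k\delta\mid \mu\in\Delta,\ k\ge 1\}$ be the set of positive affine roots, and let $\widehat W$ be the affine Weyl group, generated by the reflections of $\widehat V$ in the affine simple roots $\Pi\cup\{\delta-\theta\}$. It acts on $V$ by affine transformations, $w\cdot x$ being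 the $V$-component of $w(x+\lambda)$. For $w\in\widehat W$ put $\widehat N(w)=\{a\in\widehat\Delta^+\mid w(a)\in-\widehat\Delta^+\}$; call $w$ minuscule if $\widehat N(w)=\{\delta-\gamma\mid\gamma\in I\}$ for some $I\subset\Delta^+$, and then put $I_w=\{\gamma\in\Delta^+\mid\delta-\gamma\in\widehat N(w)\}$. Let $\mathcal A=\{x\in V\mid(\alpha,x)>0\ \forall\alpha\in\Pi,\ (\theta,x)<1\}$ and $\mathcal A_s=\{x\in V\mid(\alpha,x)>0\ \forall\alpha\in\Pi,\ (\theta_s,x)<1\}$. The alcoves are the connected components of $V\setminus\bigcup_{\mu\in\Delta^+,\,k\in\mathbb Z}\{x\mid(\mu,x)=k\}$. Proposition. For every minuscule $w\in\widehat W$, the set $I_w$ is a long Abelian ideal if and only if $w^{-1}\cdot\mathcal A\subset\mathcal A_s$, and likewise $I_w\subset\Delta^+_l$ if and only if $w^{-1}\cdot\mathcal A\subset\mathcal A_s$. Moreover, the set of long Abelian ideals and the set of alcoves contained in $\mathcal A_s$ are finite and have the same number of elements. -/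

import Mathlib

open Set

namespace LongAbelian

section RootSystem

variable {ι V N : Type*} [NormedAddCommGroup V] [InnerProductSpace ℝ V]
  [AddCommGroup N] [Module ℝ N]

/-- The inner product of `V` is invariant under the Weyl group of the root pairing `P`. -/
def IsInvariantInner (P : RootPairing ι ℝ V N) : Prop :=
  ∀ (i : ι) (x y : V), inner ℝ (P.reflection i x) (P.reflection i y) = inner ℝ x y

/-- The set `Δ` of roots, as vectors of `V`. -/
def roots (P : RootPairing ι ℝ V N) : Set V := range P.root

/-- The root system has roots of (at least) two different lengths. -/
def HasTwoRootLengths (P : RootPairing ι ℝ V N) : Prop :=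
  ∃ μ ∈ roots P, ∃ ν ∈ roots P, ‖μ‖ ≠ ‖ν‖

variable {P : RootPairing ι ℝ V N}

/-- The set `Δ⁺` of positive roots. -/
def posRoots (b : P.Base) : Set V := P.root '' {i | b.IsPos i}

/-- The set `Π` of simple roots. -/
def simpleRoots (b : P.Base) : Set V := P.root '' b.support

/-- The set `Δ⁺_l` of long positive roots. -/
def longPosRoots (b : P.Base) : Set V :=
  {γ | γ ∈ posRoots b ∧ ∀ β ∈ roots P, ‖β‖ ≤ ‖γ‖}

/-- A root of maximal height. -/
def IsHighestRoot (b : P.Base) (θ : V) : Prop :=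
  ∃ i, P.root i = θ ∧ ∀ j, b.height j ≤ b.height i

/-- A dominant root that is short, i.e. of non-maximal length. -/
def IsShortDominantRoot (b : P.Base) (θ : V) : Prop :=
  θ ∈ roots P ∧ (∃ β ∈ roots P, ‖θ‖ < ‖β‖) ∧ ∀ α ∈ simpleRoots b, 0 ≤ inner ℝ α θ

/-- The highest root `θ`. -/
noncomputable def highestRoot (b : P.Base) : V := Classical.epsilon (IsHighestRoot b)

/-- The short dominant root `θ_s`. -/
noncomputable def shortDominantRoot (b : P.Base) : V :=
  Classical.epsilon (IsShortDominantRoot b)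

theorem isHighestRoot_highestRoot [Finite ι] [Nonempty ι] (b : P.Base) :
    IsHighestRoot b (highestRoot b) := by
  obtain ⟨i, hi⟩ := Finite.exists_max b.height
  exact Classical.epsilon_spec (p := IsHighestRoot b) ⟨P.root i, i, rfl, hi⟩

theorem isShortDominantRoot_shortDominantRoot [Finite ι] [P.IsCrystallographic]
    (b : P.Base) (hP : IsInvariantInner P) (h2 : HasTwoRootLengths P) :
    IsShortDominantRoot b (shortDominantRoot b) := by
  apply Classical.epsilon_spec (p := IsShortDominantRoot b)
  have hshort : ∃ i, ∃ j, ‖P.root i‖ < ‖P.root j‖ := by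
    obtain ⟨_, ⟨i, rfl⟩, _, ⟨j, rfl⟩, hij⟩ := h2
    rcases lt_or_gt_of_ne hij with h | h
    exacts [⟨i, j, h⟩, ⟨j, i, h⟩]
  obtain ⟨i, ⟨j, hj⟩, hmax⟩ :=
    (toFinite {i | ∃ j, ‖P.root i‖ < ‖P.root j‖}).exists_maximalFor b.height _ hshort
  refine ⟨P.root i, ⟨i, rfl⟩, ⟨_, ⟨j, rfl⟩, hj⟩, ?_⟩
  rintro _ ⟨k, hk, rfl⟩
  by_contra! hneg
  have hkk : 0 < inner ℝ (P.root k) (P.root k) := real_inner_self_pos.mpr (P.ne_zero k)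
  have hpair : 2 * inner ℝ (P.root k) (P.root i)
      = P.pairing i k * inner ℝ (P.root k) (P.root k) := by
    have h := hP k (P.root k) (P.root i)
    rw [P.reflection_apply_self, P.reflection_apply_root, inner_neg_left, inner_sub_right,
      inner_smul_right] at h
    linarith
  have hp : P.pairing i k < 0 := by
    by_contra! h
    have := mul_nonneg h hkk.le
    linarith
  have hz : P.pairingIn ℤ i k < 0 := by
    rw [← P.algebraMap_pairingIn ℤ] at hp
    simpa using hp
  have hroot : P.root (P.reflectionPerm k i)
      = P.root i + (-P.pairingIn ℤ i k) • P.root k := by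
    rw [P.root_reflectionPerm, P.reflection_apply_root, ← P.algebraMap_pairingIn ℤ, neg_smul,
      sub_eq_add_neg, eq_intCast, Int.cast_smul_eq_zsmul]
  have hht := b.height_add_zsmul hroot
  rw [RootPairing.Base.height_one_of_mem_support hk, smul_eq_mul, mul_one] at hht
  have hnorm : ‖P.root (P.reflectionPerm k i)‖ = ‖P.root i‖ := by
    rw [P.root_reflectionPerm, @norm_eq_sqrt_real_inner V, @norm_eq_sqrt_real_inner V, hP]
  have := hmax (j := P.reflectionPerm k i) ⟨j, by rwa [hnorm]⟩ (by lia)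
  lia

/-- Combinatorial Abelian ideals `I ⊆ Δ⁺`. -/
structure IsAbelianIdeal (b : P.Base) (I : Set V) : Prop where
  subset_posRoots : I ⊆ posRoots b
  add_notMem_roots : ∀ μ ∈ I, ∀ ν ∈ I, μ + ν ∉ roots P
  add_mem : ∀ γ ∈ I, ∀ ν ∈ posRoots b, γ + ν ∈ roots P → γ + ν ∈ I

/-- The set of long Abelian ideals: those consisting of long roots only. -/
def longAbelianIdeals (b : P.Base) : Set (Set V) :=
  {I | IsAbelianIdeal b I ∧ I ⊆ longPosRoots b}

end RootSystem

section Affine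

variable {ι V N : Type*} [NormedAddCommGroup V] [InnerProductSpace ℝ V]
  [AddCommGroup N] [Module ℝ N]

/-- The space `V ⊕ ℝδ ⊕ ℝλ`; the triple `(x, r, t)` stands for `x + rδ + tλ`. -/
abbrev AffineSpan (V : Type*) := V × ℝ × ℝ

/-- The bilinear form on `V ⊕ ℝδ ⊕ ℝλ` that extends the inner product of `V`, with
`(δ, V) = (λ, V) = (δ, δ) = (λ, λ) = 0` and `(δ, λ) = 1`. -/
noncomputable def affineForm (u v : AffineSpan V) : ℝ :=
  inner ℝ u.1 v.1 + u.2.1 * v.2.2 + u.2.2 * v.2.1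

/-- The vector `μ + kδ`. -/
def affineRoot (μ : V) (k : ℤ) : AffineSpan V := (μ, (k : ℝ), 0)

variable {P : RootPairing ι ℝ V N}

/-- The positive affine real roots: `Δ⁺ ∪ {μ + kδ | μ ∈ Δ, k ≥ 1}`. -/
def posAffineRoots (b : P.Base) : Set (AffineSpan V) :=
  {a | ∃ μ ∈ posRoots b, a = affineRoot μ 0} ∪
    {a | ∃ μ ∈ roots P, ∃ k : ℤ, 1 ≤ k ∧ a = affineRoot μ k}

/-- The affine simple roots: `Π` together with `α₀ = δ - θ`. -/
noncomputable def simpleAffineRoots (b : P.Base) : Set (AffineSpan V) :=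
  insert (affineRoot (-highestRoot b) 1) ((fun α => affineRoot α 0) '' simpleRoots b)

/-- `g` is the orthogonal reflection `v ↦ v - (2 (v, a) / (a, a)) a`. -/
def IsReflectionAt (a : AffineSpan V) (g : AffineSpan V ≃ₗ[ℝ] AffineSpan V) : Prop :=
  ∀ v, g v = v - (2 * affineForm v a / affineForm a a) • a

theorem exists_isReflectionAt (a : AffineSpan V) (ha : affineForm a a ≠ 0) :
    ∃ g, IsReflectionAt a g := by
  let f : AffineSpan V →ₗ[ℝ] ℝ :=
    { toFun := fun v => 2 * affineForm v a / affineForm a a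
      map_add' := fun u v => by
        simp only [affineForm, Prod.fst_add, Prod.snd_add, inner_add_left]; ring
      map_smul' := fun c v => by
        simp only [affineForm, Prod.smul_fst, Prod.smul_snd, inner_smul_left, smul_eq_mul,
          RingHom.id_apply, conj_trivial]
        ring }
  have hf : f a = 2 := by
    change 2 * affineForm a a / affineForm a a = 2
    field_simp
  exact ⟨Module.reflection hf, fun v => by rw [Module.reflection_apply]; rfl⟩

/-- The affine Weyl group, acting linearly on `V ⊕ ℝδ ⊕ ℝλ`, generated by the simple
reflections `s₀, …, s_p`. -/
def affineWeylGroup (b : P.Base) : Subgroup (AffineSpan V ≃ₗ[ℝ] AffineSpan V) :=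
  Subgroup.closure {g | ∃ a ∈ simpleAffineRoots b, IsReflectionAt a g}

/-- The affine-linear action of the affine Weyl group on `V`: the group preserves
`V + ℝδ + λ` and fixes `δ`, and `V` is identified with `(V + ℝδ + λ) / ℝδ`. -/
def dot {b : P.Base} (w : affineWeylGroup b) (x : V) : V := (w.1 (x, 0, 1)).1

/-- The set of positive affine roots that `w` makes negative. -/
def inversionSet {b : P.Base} (w : affineWeylGroup b) : Set (AffineSpan V) :=
  {a | a ∈ posAffineRoots b ∧ -(w.1 a) ∈ posAffineRoots b}

/-- `w` is minuscule: its inversion set is `{δ - γ | γ ∈ I}` for some `I ⊆ Δ⁺`. -/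
def IsMinuscule {b : P.Base} (w : affineWeylGroup b) : Prop :=
  ∃ I ⊆ posRoots b, inversionSet w = (fun γ => affineRoot (-γ) 1) '' I

/-- The set `I_w` of those positive roots `γ` for which `δ - γ` is an inversion of `w`. -/
def idealOf {b : P.Base} (w : affineWeylGroup b) : Set V :=
  {γ | γ ∈ posRoots b ∧ affineRoot (-γ) 1 ∈ inversionSet w}

/-- The complement in `V` of all hyperplanes `(μ, x) = k`, `μ ∈ Δ⁺`, `k ∈ ℤ`. -/
def hyperplaneComplement (b : P.Base) : Set V :=
  {x | ∀ μ ∈ posRoots b, ∀ k : ℤ, inner ℝ μ x ≠ k}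

/-- The alcoves: the connected components of the complement of the hyperplanes. -/
def alcoves (b : P.Base) : Set (Set V) :=
  {C | ∃ x ∈ hyperplaneComplement b, C = connectedComponentIn (hyperplaneComplement b) x}

/-- The fundamental alcove. -/
def fundamentalAlcove (b : P.Base) : Set V :=
  {x | (∀ α ∈ simpleRoots b, 0 < inner ℝ α x) ∧ inner ℝ (highestRoot b) x < 1}

/-- The simplex `A_s`. -/
def shortSimplex (b : P.Base) : Set V :=
  {x | (∀ α ∈ simpleRoots b, 0 < inner ℝ α x) ∧ inner ℝ (shortDominantRoot b) x < 1}

end Affine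

end LongAbelian

namespace LongAbelian

/-! ### Roots, lengths and dominance -/

section RootSystem

variable {ι V N : Type*} [NormedAddCommGroup V] [InnerProductSpace ℝ V]
  [AddCommGroup N] [Module ℝ N] {P : RootPairing ι ℝ V N}

/-! To a point y with (α, y) > 0 for all simple α attach the set `rootsAboveOne b y` of positive
roots γ with (γ, y) > 1. The value (μ, y) + k of an affine root μ + kδ at y = w⁻¹·x equals the value
of w(μ + kδ) at x (`inner_dot_inv`), and positive affine roots are positive on 𝒜. Hence I_w is
`rootsAboveOne` at w⁻¹·x for any x in 𝒜, and for minuscule w this point is dominant.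

On dominant points θ_s bounds every short root, and 2θ_s bounds every root, because a long dominant
root is the sum of θ_s and a short root. So on 𝒜_s short roots stay below 1 and all roots below 2:
the attached set is long, and no two of its elements add up to a root. Conversely a long set omits
θ_s, which forces (θ_s, y) < 1. These comparisons rest on irreducibility, through
`IsDominant.inner_pos`.

For the count, positive roots take values in (0, 2) on 𝒜_s, so the attached ideal determines all
integral parts and hence the alcove. Every long Abelian ideal arises, by induction on its size:
remove an element γ of least height, take a point for the smaller ideal, and reflect it in (γ, x) =
1. By `affine_sign_reflection` this crosses no other hyperplane. The count thus needs no minuscule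
elements. -/

theorem finite_roots [Finite ι] : (roots P).Finite := finite_range _

theorem neg_mem_roots {μ : V} (h : μ ∈ roots P) : -μ ∈ roots P := by
  obtain ⟨i, rfl⟩ := h
  exact ⟨P.reflectionPerm i i, by simp⟩

theorem ne_zero_of_mem_roots {μ : V} (h : μ ∈ roots P) : μ ≠ 0 := by
  obtain ⟨i, rfl⟩ := h
  exact P.ne_zero i

/-- The invariant form of a root pairing that is given by an invariant inner product. -/
noncomputable def invariantForm (hP : IsInvariantInner P) : P.InvariantForm where
  form := innerₗ V
  symm := ⟨fun x y => by simp [real_inner_comm]⟩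
  ne_zero i := by simpa using P.ne_zero i
  isOrthogonal_reflection i x y := by simpa using hP i x y

theorem invariantForm_apply (hP : IsInvariantInner P) (x y : V) :
    (invariantForm hP).form x y = inner ℝ x y := rfl

theorem two_mul_inner_root (hP : IsInvariantInner P) (i j : ι) :
    2 * inner ℝ (P.root i) (P.root j) =
      P.pairing i j * inner ℝ (P.root j) (P.root j) :=
  (invariantForm hP).two_mul_apply_root_root i j

theorem inner_root_self_pos (j : ι) : 0 < inner ℝ (P.root j) (P.root j) :=
  real_inner_self_pos.mpr (P.ne_zero j)

theorem exists_int_pairing [P.IsCrystallographic] (hP : IsInvariantInner P) {μ ν : V}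
    (hμ : μ ∈ roots P) (hν : ν ∈ roots P) :
    ∃ n : ℤ, 2 * inner ℝ μ ν = n * inner ℝ ν ν ∧ μ - (n : ℝ) • ν ∈ roots P := by
  obtain ⟨i, rfl⟩ := hμ
  obtain ⟨j, rfl⟩ := hν
  refine ⟨P.pairingIn ℤ i j, ?_, P.reflectionPerm j i, ?_⟩
  · rw [two_mul_inner_root hP, ← P.algebraMap_pairingIn ℤ]; rfl
  · rw [P.root_reflectionPerm, P.reflection_apply_root, ← P.algebraMap_pairingIn ℤ]; rfl

theorem sub_mem_roots [Finite ι] [P.IsCrystallographic] (hP : IsInvariantInner P) {μ ν : V}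
    (hμ : μ ∈ roots P) (hν : ν ∈ roots P) (h : 0 < inner ℝ μ ν) (hne : μ ≠ ν) :
    μ - ν ∈ roots P := by
  obtain ⟨i, rfl⟩ := hμ
  obtain ⟨j, rfl⟩ := hν
  refine P.root_sub_root_mem_of_pairingIn_pos ?_ (fun h => hne (by rw [h]))
  have h1 := two_mul_inner_root hP i j
  rw [← P.algebraMap_pairingIn ℤ, eq_intCast] at h1
  have h2 : (0 : ℝ) < P.pairingIn ℤ i j := by
    by_contra! h3
    have := mul_nonpos_of_nonpos_of_nonneg h3 (inner_root_self_pos (P := P) j).le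
    linarith
  exact_mod_cast h2

/-- Roots that are not of maximal length all have the same length. -/
theorem norm_eq_of_norm_lt [Finite ι] [P.IsCrystallographic] [P.IsReduced] [P.IsIrreducible]
    (hP : IsInvariantInner P) {μ ν β β' : V} (hμ : μ ∈ roots P) (hν : ν ∈ roots P)
    (hβ : β ∈ roots P) (hβ' : β' ∈ roots P) (h : ‖μ‖ < ‖β‖) (h' : ‖ν‖ < ‖β'‖) :
    ‖μ‖ = ‖ν‖ := by
  obtain ⟨i, rfl⟩ := hμ
  obtain ⟨j, rfl⟩ := hν
  obtain ⟨k, rfl⟩ := hβ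
  obtain ⟨l, rfl⟩ := hβ'
  by_contra hne
  -- Two different lengths would be the only ones, by irreducibility; then the larger of them could
  -- not be exceeded.
  have key (m : ι) := (invariantForm hP).apply_eq_or_of_apply_ne (i := i) (j := j) (by
    rw [invariantForm_apply, invariantForm_apply, real_inner_self_eq_norm_sq,
      real_inner_self_eq_norm_sq]
    intro h
    exact hne ((sq_eq_sq₀ (norm_nonneg _) (norm_nonneg _)).mp h)) m
  simp only [invariantForm_apply, real_inner_self_eq_norm_sq,
    sq_eq_sq₀ (norm_nonneg _) (norm_nonneg _)] at key
  rcases key k with h1 | h1 <;> rcases key l with h2 | h2 <;> grind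

/-- A root pairs with a root that is at least as long, and not parallel to it, to at most `1`. -/
theorem pairing_lt_two {μ γ : V} (hne : μ ≠ γ) (hle : ‖μ‖ ≤ ‖γ‖) (h0 : γ ≠ 0) {n : ℤ}
    (hn : 2 * inner ℝ μ γ = n * inner ℝ γ γ) : n < 2 := by
  by_contra! h
  have hγ : 0 < inner ℝ γ γ := real_inner_self_pos.mpr h0
  -- Expanding gives 0 < |μ|² − n|γ|² + |γ|² ≤ (2 − n)|γ|².
  have h1 : 0 < ‖μ - γ‖ ^ 2 := by
    have := norm_pos_iff.mpr (sub_ne_zero.mpr hne)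
    positivity
  rw [norm_sub_sq_real, hn, ← real_inner_self_eq_norm_sq γ] at h1
  have h2 : ‖μ‖ ^ 2 ≤ ‖γ‖ ^ 2 := by gcongr
  rw [← real_inner_self_eq_norm_sq γ] at h2
  have h3 : (2 : ℝ) ≤ n := by exact_mod_cast h
  nlinarith

theorem norm_sub_smul_eq {μ ν : V} {c : ℝ} (hc : 2 * inner ℝ μ ν = c * inner ℝ ν ν) :
    ‖μ - c • ν‖ = ‖μ‖ := by
  rw [← sq_eq_sq₀ (norm_nonneg _) (norm_nonneg _), norm_sub_sq_real, inner_smul_right, norm_smul,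
    mul_pow, Real.norm_eq_abs, sq_abs, ← real_inner_self_eq_norm_sq ν]
  linear_combination -c * hc

/-! ### Simple roots, height and the positive cone -/

theorem simpleRoots_subset_roots (b : P.Base) : simpleRoots b ⊆ roots P :=
  image_subset_range _ _

theorem posRoots_subset_roots (b : P.Base) : posRoots b ⊆ roots P :=
  image_subset_range _ _

/-- The simple roots form a basis, so some functional is 1 on all of them, and the inner product
represents it. Pairing with the resulting vector is the height. -/
theorem exists_inner_simpleRoots_eq_one [P.IsRootSystem] (b : P.Base) :
    ∃ ρ : V, ∀ α ∈ simpleRoots b, inner ℝ α ρ = 1 := by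
  have : FiniteDimensional ℝ V := b.toWeightBasis.finiteDimensional_of_finite
  let f : V →ₗ[ℝ] ℝ := b.toWeightBasis.constr ℝ fun _ => 1
  refine ⟨(InnerProductSpace.toDual ℝ V).symm f.toContinuousLinearMap, ?_⟩
  rintro _ ⟨i, hi, rfl⟩
  rw [real_inner_comm, InnerProductSpace.toDual_symm_apply]
  have := b.toWeightBasis.constr_basis ℝ (fun _ => (1 : ℝ)) ⟨i, hi⟩
  rwa [RootPairing.Base.toWeightBasis_apply] at this

/-- A vector whose inner product with each simple root is `1`. -/
noncomputable def coweight [P.IsRootSystem] (b : P.Base) : V :=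
  (exists_inner_simpleRoots_eq_one b).choose

theorem inner_coweight [P.IsRootSystem] (b : P.Base) {α : V} (hα : α ∈ simpleRoots b) :
    inner ℝ α (coweight b) = 1 :=
  (exists_inner_simpleRoots_eq_one b).choose_spec α hα

theorem inner_root_coweight [P.IsRootSystem] (b : P.Base) (i : ι) :
    inner ℝ (P.root i) (coweight b) = b.height i := by
  obtain ⟨f, -, -, hf⟩ := b.exists_root_eq_sum_int i
  rw [RootPairing.Base.height_eq_sum hf, hf, sum_inner, Int.cast_sum]
  refine Finset.sum_congr rfl fun j hj => ?_
  rw [← Int.cast_smul_eq_zsmul ℝ, real_inner_smul_left, inner_coweight b ⟨j, hj, rfl⟩, mul_one]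

theorem mem_posRoots_iff [P.IsRootSystem] {b : P.Base} {μ : V} :
    μ ∈ posRoots b ↔ μ ∈ roots P ∧ 0 < inner ℝ μ (coweight b) := by
  constructor
  · rintro ⟨i, hi, rfl⟩
    refine ⟨⟨i, rfl⟩, ?_⟩
    rw [inner_root_coweight]
    exact_mod_cast b.isPos_iff.mp hi
  · rintro ⟨⟨i, rfl⟩, h⟩
    rw [inner_root_coweight] at h
    exact ⟨i, b.isPos_iff.mpr (by exact_mod_cast h), rfl⟩

theorem mem_posRoots_or_neg_mem [P.IsRootSystem] (b : P.Base) {μ : V} (hμ : μ ∈ roots P) :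
    μ ∈ posRoots b ∨ -μ ∈ posRoots b := by
  rw [mem_posRoots_iff, mem_posRoots_iff, inner_neg_left]
  have h : inner ℝ μ (coweight b) ≠ 0 := by
    obtain ⟨i, rfl⟩ := hμ
    rw [inner_root_coweight]
    exact_mod_cast b.height_ne_zero i
  rcases lt_or_gt_of_ne h with h | h
  · exact Or.inr ⟨neg_mem_roots hμ, by linarith⟩
  · exact Or.inl ⟨hμ, h⟩

theorem simpleRoots_subset_posRoots [P.IsRootSystem] (b : P.Base) :
    simpleRoots b ⊆ posRoots b := fun α hα =>
  mem_posRoots_iff.mpr ⟨simpleRoots_subset_roots b hα, by rw [inner_coweight b hα]; norm_num⟩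

/-- The non-negative integral combinations of simple roots. -/
def posCone (b : P.Base) : AddSubmonoid V := AddSubmonoid.closure (simpleRoots b)

/-- `y` lies in the closed dominant chamber. -/
def IsDominant (b : P.Base) (y : V) : Prop := ∀ α ∈ simpleRoots b, 0 ≤ inner ℝ α y

theorem IsDominant.inner_nonneg {b : P.Base} {y v : V} (hy : IsDominant b y)
    (hv : v ∈ posCone b) : 0 ≤ inner ℝ v y := by
  induction hv using AddSubmonoid.closure_induction with
  | mem x hx => exact hy x hx
  | zero => simp
  | add x z _ _ hx hz => rw [inner_add_left]; positivity

theorem isDominant_coweight [P.IsRootSystem] (b : P.Base) : IsDominant b (coweight b) :=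
  fun α hα => by rw [inner_coweight b hα]; norm_num

theorem eq_zero_of_mem_posCone [P.IsRootSystem] {b : P.Base} {v : V} (hv : v ∈ posCone b)
    (h : inner ℝ v (coweight b) ≤ 0) : v = 0 := by
  have key : v = 0 ∨ 0 < inner ℝ v (coweight b) := by
    clear h
    induction hv using AddSubmonoid.closure_induction with
    | mem x hx => right; rw [inner_coweight b hx]; norm_num
    | zero => simp
    | add x z _ _ hx hz =>
      rcases hx with rfl | hx <;> rcases hz with rfl | hz
      · simp
      · simpa using Or.inr hz
      · simpa using Or.inr hx
      · right; rw [inner_add_left]; positivity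
  exact key.resolve_right h.not_gt

theorem posRoots_subset_posCone [P.IsRootSystem] {b : P.Base} {μ : V} (hμ : μ ∈ posRoots b) :
    μ ∈ posCone b := by
  obtain ⟨i, hi, rfl⟩ := id hμ
  rcases b.root_mem_or_neg_mem i with h | h
  · exact h
  · have h1 := (isDominant_coweight b).inner_nonneg h
    have h2 := (mem_posRoots_iff.mp hμ).2
    rw [inner_neg_left] at h1
    linarith

theorem exists_eq_sum_of_mem_posCone {b : P.Base} {v : V} (hv : v ∈ posCone b) :
    ∃ c : ι → ℝ, (∀ i, 0 ≤ c i) ∧ v = ∑ i ∈ b.support, c i • P.root i := by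
  classical
  induction hv using AddSubmonoid.closure_induction with
  | mem x hx =>
    obtain ⟨i, hi, rfl⟩ := hx
    refine ⟨Pi.single i 1, fun j => ?_, ?_⟩
    · by_cases h : j = i
      · subst h; simp
      · simp [h]
    · rw [Finset.sum_eq_single i (fun j _ hj => by simp [hj]) (fun h => absurd hi h)]
      simp
  | zero => exact ⟨0, fun _ => le_rfl, by simp⟩
  | add x z _ _ hx hz =>
    obtain ⟨c, hc, rfl⟩ := hx
    obtain ⟨d, hd, rfl⟩ := hz
    exact ⟨c + d, fun i => add_nonneg (hc i) (hd i), by simp [add_smul, Finset.sum_add_distrib]⟩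

/-! ### Dominant roots and the bounds they give -/

theorem IsDominant.mem_posRoots [P.IsRootSystem] {b : P.Base} {φ : V} (hφ : φ ∈ roots P)
    (hd : IsDominant b φ) : φ ∈ posRoots b := by
  refine (mem_posRoots_or_neg_mem b hφ).resolve_right fun h => ?_
  have h1 := hd.inner_nonneg (posRoots_subset_posCone h)
  have h2 : 0 < inner ℝ φ φ := real_inner_self_pos.mpr (ne_zero_of_mem_roots hφ)
  rw [inner_neg_left] at h1
  linarith

/-- In an irreducible root system, the inner product of a dominant root with a nonzero dominant
vector is positive. -/
theorem IsDominant.inner_pos [Finite ι] [P.IsRootSystem] [P.IsCrystallographic] [P.IsReduced]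
    [P.IsIrreducible] (hP : IsInvariantInner P)
    {b : P.Base} {φ y : V} (hφ : φ ∈ roots P) (hd : IsDominant b φ) (hy : IsDominant b y)
    (hy0 : y ≠ 0) : 0 < inner ℝ φ y := by
  have hpos := posRoots_subset_posCone (hd.mem_posRoots hφ)
  refine (hy.inner_nonneg hpos).lt_of_ne' fun h0 => ?_
  obtain ⟨c, hc, hφc⟩ := exists_eq_sum_of_mem_posCone hpos
  -- The simple roots occurring in φ span a subspace stable under all reflections, hence all of V by
  -- irreducibility; and (φ, y) = 0 makes y orthogonal to it.
  let s : Set ι := {i | i ∈ b.support ∧ 0 < c i}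
  let q : Submodule ℝ V := Submodule.span ℝ (P.root '' s)
  have hs : ∀ i ∈ b.support, i ∉ s → c i = 0 := fun i hi his =>
    le_antisymm (not_lt.mp fun h => his ⟨hi, h⟩) (hc i)
  have hinv : ∀ j, q ∈ Module.End.invtSubmodule (P.reflection j).toLinearMap := by
    refine (b.forall_mem_support_invtSubmodule_iff q).mp fun j hj => ?_
    by_cases hjs : j ∈ s
    · exact Submodule.mem_invtSubmodule_reflection_of_mem _ _
        (Submodule.subset_span ⟨j, hjs, rfl⟩)
    · have horth : ∀ i ∈ s, inner ℝ (P.root i) (P.root j) = 0 := by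
        have hle : ∀ i ∈ b.support, c i * inner ℝ (P.root i) (P.root j) ≤ 0 := by
          intro i hi
          by_cases hij : i = j
          · rw [hij, hs j hj hjs, zero_mul]
          · refine mul_nonpos_of_nonneg_of_nonpos (hc i) ?_
            by_contra! h
            exact b.sub_notMem_range_root hi hj (sub_mem_roots hP ⟨i, rfl⟩ ⟨j, rfl⟩ h
              (fun h => hij (P.root.injective h)))
        have hsum : ∑ i ∈ b.support, c i * inner ℝ (P.root i) (P.root j) = inner ℝ φ (P.root j) := by
          rw [hφc, sum_inner]
          exact Finset.sum_congr rfl fun i _ => (real_inner_smul_left _ _ _).symm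
        have hge : 0 ≤ inner ℝ φ (P.root j) := by
          rw [real_inner_comm]; exact hd _ ⟨j, hj, rfl⟩
        have hz := (Finset.sum_eq_zero_iff_of_nonpos hle).mp
          (le_antisymm (Finset.sum_nonpos hle) (hsum ▸ hge))
        intro i hi
        exact (mul_eq_zero.mp (hz i hi.1)).resolve_left hi.2.ne'
      refine (Module.End.mem_invtSubmodule _).mpr fun x hx => ?_
      have hx0 : inner ℝ x (P.root j) = 0 := by
        induction hx using Submodule.span_induction with
        | mem x hx => obtain ⟨i, hi, rfl⟩ := hx; exact horth i hi
        | zero => simp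
        | add x z _ _ hx hz => rw [inner_add_left, hx, hz, add_zero]
        | smul a x _ hx => rw [real_inner_smul_left, hx, mul_zero]
      have hfix : P.reflection j x = x := by
        have h1 := hP j x (P.root j)
        rw [P.reflection_apply_self, inner_neg_right, P.reflection_apply, inner_sub_left,
          real_inner_smul_left, hx0] at h1
        have h2 := inner_root_self_pos (P := P) j
        have h3 : P.toLinearMap x (P.coroot j) = 0 := by
          have : P.toLinearMap x (P.coroot j) * inner ℝ (P.root j) (P.root j) = 0 := by
            simpa using h1
          exact (mul_eq_zero.mp this).resolve_right h2.ne'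
        rw [P.reflection_apply]
        simp [h3]
      simpa [hfix] using hx
  have hne : q ≠ ⊥ := by
    intro hq
    apply ne_zero_of_mem_roots hφ
    rw [hφc]
    refine Finset.sum_eq_zero fun i hi => ?_
    by_cases his : i ∈ s
    · exact absurd ((Submodule.mem_bot ℝ).mp (hq ▸ Submodule.subset_span ⟨i, his, rfl⟩)) (P.ne_zero i)
    · rw [hs i hi his, zero_smul]
  have htop := RootPairing.IsIrreducible.eq_top_of_invtSubmodule_reflection q hinv hne
  have hterm : ∀ i ∈ s, inner ℝ (P.root i) y = 0 := by
    have hnn : ∀ i ∈ b.support, 0 ≤ c i * inner ℝ (P.root i) y := fun i hi =>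
      mul_nonneg (hc i) (hy _ ⟨i, hi, rfl⟩)
    have hsum : ∑ i ∈ b.support, c i * inner ℝ (P.root i) y = 0 := by
      rw [← h0, hφc, sum_inner]
      exact Finset.sum_congr rfl fun i _ => (real_inner_smul_left _ _ _).symm
    intro i hi
    exact (mul_eq_zero.mp ((Finset.sum_eq_zero_iff_of_nonneg hnn).mp hsum i hi.1)).resolve_left
      hi.2.ne'
  have hyq : y ∈ q := htop ▸ Submodule.mem_top
  have hall : ∀ x ∈ q, inner ℝ x y = 0 := by
    intro x hx
    induction hx using Submodule.span_induction with
    | mem x hx => obtain ⟨i, hi, rfl⟩ := hx; exact hterm i hi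
    | zero => simp
    | add x z _ _ hx hz => rw [inner_add_left, hx, hz, add_zero]
    | smul a x _ hx => rw [real_inner_smul_left, hx, mul_zero]
  exact hy0 (inner_self_eq_zero.mp (hall y hyq))

/-- Every root lies below a dominant root of the same length. -/
theorem exists_isDominant_ge [Finite ι] [P.IsRootSystem] [P.IsCrystallographic]
    (hP : IsInvariantInner P) (b : P.Base) {ν : V} (hν : ν ∈ roots P) :
    ∃ β ∈ roots P, ‖β‖ = ‖ν‖ ∧ IsDominant b β ∧ β - ν ∈ posCone b := by
  let S : Set V := {β | β ∈ roots P ∧ ‖β‖ = ‖ν‖ ∧ β - ν ∈ posCone b}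
  have hfin : S.Finite := finite_roots.subset fun β h => h.1
  obtain ⟨β, ⟨hβ, hn, hc⟩, hmax⟩ := hfin.exists_maximalFor (fun v => inner ℝ v (coweight b)) S
    ⟨ν, hν, rfl, by rw [sub_self]; exact zero_mem _⟩
  refine ⟨β, hβ, hn, fun α hα => ?_, hc⟩
  -- If (β, α) < 0, reflecting β in α adds a positive multiple of α and yields a higher element of
  -- `S`.
  by_contra! h
  have hα' := simpleRoots_subset_roots b hα
  obtain ⟨n, h1, h2⟩ := exists_int_pairing hP hβ hα'
  have hαα : 0 < inner ℝ α α := real_inner_self_pos.mpr (ne_zero_of_mem_roots hα')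
  rw [real_inner_comm] at h
  have hn0 : (n : ℝ) < 0 := by
    by_contra! h3
    have := mul_nonneg h3 hαα.le
    linarith
  have hn0' : n < 0 := by exact_mod_cast hn0
  have hmem : β - (n : ℝ) • α ∈ S := by
    refine ⟨h2, (norm_sub_smul_eq h1).trans hn, ?_⟩
    obtain ⟨m, hm⟩ := Int.eq_ofNat_of_zero_le (neg_nonneg.mpr hn0'.le)
    have : β - (n : ℝ) • α - ν = (β - ν) + m • α := by
      have : (n : ℝ) = -(m : ℝ) := by
        rw [show n = -(m : ℤ) by lia]; push_cast; rfl
      rw [this, neg_smul, Nat.cast_smul_eq_nsmul]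
      abel
    rw [this]
    exact add_mem hc (nsmul_mem (AddSubmonoid.subset_closure hα) m)
  have hlt : inner ℝ β (coweight b) < inner ℝ (β - (n : ℝ) • α) (coweight b) := by
    rw [inner_sub_left, real_inner_smul_left, inner_coweight b hα]
    linarith
  exact absurd (hmax hmem hlt.le) hlt.not_ge

/-- A dominant root is the largest root of its length. -/
theorem IsDominant.sub_mem_posCone [Finite ι] [P.IsRootSystem] [P.IsCrystallographic]
    [P.IsReduced] [P.IsIrreducible] (hP : IsInvariantInner P) {b : P.Base} {φ ν : V}
    (hφ : φ ∈ roots P) (hd : IsDominant b φ) (hν : ν ∈ roots P) (h : ‖ν‖ = ‖φ‖) :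
    φ - ν ∈ posCone b := by
  obtain ⟨β, hβ, hn, hdβ, hc⟩ := exists_isDominant_ge hP b hν
  suffices β = φ by rwa [← this]
  by_contra hne
  -- Whichever sign the root β − φ has, pairing it with φ or β gives (β, φ) ≥ |φ|², impossible for
  -- distinct vectors of equal length.
  have hroot := sub_mem_roots hP hβ hφ
    (hdβ.inner_pos hP hβ hd (ne_zero_of_mem_roots hφ)) hne
  have h1 : 0 < ‖β - φ‖ ^ 2 := by
    have := norm_pos_iff.mpr (sub_ne_zero.mpr hne)
    positivity
  rw [norm_sub_sq_real, hn, h] at h1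
  have h2 := real_inner_self_eq_norm_sq φ
  have h3 := real_inner_self_eq_norm_sq β
  rw [hn, h] at h3
  rcases mem_posRoots_or_neg_mem b hroot with hp | hp
  · have := hd.inner_nonneg (posRoots_subset_posCone hp)
    rw [inner_sub_left] at this
    linarith
  · have := hdβ.inner_nonneg (posRoots_subset_posCone hp)
    rw [neg_sub, inner_sub_left, real_inner_comm] at this
    linarith

theorem highestRoot_mem_roots [Finite ι] [Nonempty ι] (b : P.Base) :
    highestRoot b ∈ roots P := by
  obtain ⟨i, hi, -⟩ := isHighestRoot_highestRoot b
  exact ⟨i, hi⟩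

/-- Every root lies below the highest root. -/
theorem highestRoot_sub_mem_posCone [Finite ι] [P.IsRootSystem] [P.IsCrystallographic]
    [P.IsReduced] [P.IsIrreducible] (hP : IsInvariantInner P) (b : P.Base) {ν : V}
    (hν : ν ∈ roots P) : highestRoot b - ν ∈ posCone b := by
  have : Nonempty ι := ⟨hν.choose⟩
  have hθ := highestRoot_mem_roots b
  have hmax : ∀ β ∈ roots P,
      inner ℝ β (coweight b) ≤ inner ℝ (highestRoot b) (coweight b) := by
    obtain ⟨i, hi, hm⟩ := isHighestRoot_highestRoot b
    rintro _ ⟨j, rfl⟩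
    rw [← hi, inner_root_coweight, inner_root_coweight]
    exact_mod_cast hm j
  have hdom : IsDominant b (highestRoot b) := by
    obtain ⟨β, hβ, -, hd, hc⟩ := exists_isDominant_ge hP b hθ
    have := eq_zero_of_mem_posCone hc (by
      rw [inner_sub_left]; linarith [hmax β hβ])
    rwa [← sub_eq_zero.mp this]
  obtain ⟨β, hβ, -, hd, hc⟩ := exists_isDominant_ge hP b hν
  by_cases hne : highestRoot b = β
  · rwa [hne]
  have hroot := sub_mem_roots hP hθ hβ
    (hdom.inner_pos hP hθ hd (ne_zero_of_mem_roots hβ)) hne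
  -- The difference θ − β cannot be negative, as β would then be higher than θ.
  rcases mem_posRoots_or_neg_mem b hroot with hp | hp
  · rw [← sub_add_sub_cancel _ β]
    exact add_mem (posRoots_subset_posCone hp) hc
  · have := (mem_posRoots_iff.mp hp).2
    rw [neg_sub, inner_sub_left] at this
    linarith [hmax β hβ]

/-- On dominant vectors, the short dominant root bounds the roots that are not long. -/
theorem inner_le_inner_shortDominantRoot [Finite ι] [P.IsRootSystem] [P.IsCrystallographic]
    [P.IsReduced] [P.IsIrreducible] (hP : IsInvariantInner P) (h2 : HasTwoRootLengths P)
    {b : P.Base} {ν β y : V} (hν : ν ∈ roots P) (hβ : β ∈ roots P) (hlt : ‖ν‖ < ‖β‖)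
    (hy : IsDominant b y) : inner ℝ ν y ≤ inner ℝ (shortDominantRoot b) y := by
  obtain ⟨hs, ⟨κ, hκ, hsκ⟩, hd⟩ := isShortDominantRoot_shortDominantRoot b hP h2
  have := hy.inner_nonneg (IsDominant.sub_mem_posCone hP hs hd hν
    (norm_eq_of_norm_lt hP hν hs hβ hκ hlt hsκ))
  rw [inner_sub_left] at this
  linarith

/-- On dominant vectors, twice the short dominant root bounds all roots. -/
theorem inner_le_two_mul_inner_shortDominantRoot [Finite ι] [P.IsRootSystem]
    [P.IsCrystallographic] [P.IsReduced] [P.IsIrreducible] (hP : IsInvariantInner P)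
    (h2 : HasTwoRootLengths P) {b : P.Base} {ν y : V} (hν : ν ∈ roots P) (hy : IsDominant b y) :
    inner ℝ ν y ≤ 2 * inner ℝ (shortDominantRoot b) y := by
  have : Nonempty ι := ⟨hν.choose⟩
  obtain ⟨hs, ⟨κ, hκ, hsκ⟩, hd⟩ := isShortDominantRoot_shortDominantRoot b hP h2
  set σ := shortDominantRoot b
  obtain ⟨φ, hθ, -, hdom, hc⟩ := exists_isDominant_ge hP b hν
  have h1 := hy.inner_nonneg hc
  rw [inner_sub_left] at h1
  have h0 := hy.inner_nonneg (posRoots_subset_posCone (IsDominant.mem_posRoots hs hd))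
  by_cases hlong : ∃ κ' ∈ roots P, ‖φ‖ < ‖κ'‖
  · obtain ⟨κ', hκ', hlt⟩ := hlong
    have := inner_le_inner_shortDominantRoot hP h2 hθ hκ' hlt hy
    linarith
  push Not at hlong
  have hlt : ‖σ‖ < ‖φ‖ := hsκ.trans_le (hlong κ hκ)
  have hne : φ ≠ σ := fun h => by rw [h] at hlt; exact hlt.false
  have hpos := hdom.inner_pos hP hθ hd (ne_zero_of_mem_roots hs)
  have hroot := sub_mem_roots hP hθ hs hpos hne
  obtain ⟨n, hn, -⟩ := exists_int_pairing hP hs hθ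
  have hn2 := pairing_lt_two hne.symm hlt.le (ne_zero_of_mem_roots hθ) hn
  have hφφ : 0 < inner ℝ φ φ := real_inner_self_pos.mpr (ne_zero_of_mem_roots hθ)
  have hn0 : (0 : ℝ) < n := by
    by_contra! h3
    have := mul_nonpos_of_nonpos_of_nonneg h3 hφφ.le
    rw [real_inner_comm] at hpos
    linarith
  have hn0' : 0 < n := by exact_mod_cast hn0
  obtain rfl : n = 1 := by lia
  -- With pairing 1, σ − φ is the reflection of σ in φ. So φ − σ is a short root, itself bounded by
  -- σ on y.
  have hnorm : ‖φ - σ‖ = ‖σ‖ := by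
    rw [norm_sub_rev, ← norm_sub_smul_eq hn]; simp
  have := inner_le_inner_shortDominantRoot hP h2 hroot hκ (hnorm ▸ hsκ) hy
  rw [inner_sub_left] at this
  linarith

end RootSystem

/-! ### Alcoves and the ideals attached to them -/

section Alcoves

variable {ι V N : Type*} [NormedAddCommGroup V] [InnerProductSpace ℝ V]
  [AddCommGroup N] [Module ℝ N] {P : RootPairing ι ℝ V N}

/-- The positive roots whose value at `y` exceeds `1`. -/
def rootsAboveOne (b : P.Base) (y : V) : Set V := {γ | γ ∈ posRoots b ∧ 1 < inner ℝ γ y}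

/-- An alcove consists of the points having the same integral parts of all root values. -/
theorem connectedComponentIn_hyperplaneComplement {b : P.Base} {x : V}
    (hx : x ∈ hyperplaneComplement b) :
    connectedComponentIn (hyperplaneComplement b) x =
      {y | y ∈ hyperplaneComplement b ∧
        ∀ μ ∈ posRoots b, ⌊inner ℝ μ y⌋ = ⌊inner ℝ μ x⌋} := by
  apply Subset.antisymm
  · intro y hy
    have hsub := connectedComponentIn_subset (hyperplaneComplement b) x
    refine ⟨hsub hy, fun μ hμ => ?_⟩
    -- The image is an interval; if floors differed at its points, it would contain the larger
    -- floor, an integer.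
    have hpre : ((fun z => inner ℝ μ z) '' connectedComponentIn (hyperplaneComplement b) x
        : Set ℝ).OrdConnected :=
      (isPreconnected_connectedComponentIn.image _ (by fun_prop)).ordConnected
    have hmx := mem_image_of_mem (fun z => inner ℝ μ z) (mem_connectedComponentIn hx)
    have hmy := mem_image_of_mem (fun z => inner ℝ μ z) hy
    by_contra hne
    rcases lt_or_gt_of_ne hne with h | h
    · obtain ⟨z, hz, hzk⟩ := (hpre.out hmy hmx :)
        (⟨(Int.floor_lt.mp h).le, Int.floor_le _⟩ : _ ∈ Icc _ _)
      exact hsub hz μ hμ _ hzk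
    · obtain ⟨z, hz, hzk⟩ := (hpre.out hmx hmy :)
        (⟨(Int.floor_lt.mp h).le, Int.floor_le _⟩ : _ ∈ Icc _ _)
      exact hsub hz μ hμ _ hzk
  -- An intersection of open slabs between consecutive integers is convex, hence connected, and
  -- meets no hyperplane.
  · have hconv : Convex ℝ {y : V | ∀ μ ∈ posRoots b,
        ((⌊inner ℝ μ x⌋ : ℝ) < inner ℝ μ y ∧ inner ℝ μ y < (⌊inner ℝ μ x⌋ : ℝ) + 1)} := by
      intro y hy z hz s t hs ht hst μ hμ
      have hl : inner ℝ μ (s • y + t • z) = s * inner ℝ μ y + t * inner ℝ μ z := by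
        rw [inner_add_right, real_inner_smul_right, real_inner_smul_right]
      rw [hl]
      have := convex_Ioo ((⌊inner ℝ μ x⌋ : ℝ)) ((⌊inner ℝ μ x⌋ : ℝ) + 1) (hy μ hμ) (hz μ hμ)
        hs ht hst
      exact this
    have hfl {y : V} (hy : y ∈ hyperplaneComplement b) {μ : V} (hμ : μ ∈ posRoots b) :
        (⌊inner ℝ μ y⌋ : ℝ) < inner ℝ μ y ∧ inner ℝ μ y < (⌊inner ℝ μ y⌋ : ℝ) + 1 :=
      ⟨lt_of_le_of_ne (Int.floor_le _) (hy μ hμ _).symm, Int.lt_floor_add_one _⟩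
    refine Subset.trans ?_ (hconv.isPreconnected.subset_connectedComponentIn
      (fun μ hμ => hfl hx hμ) ?_)
    · rintro y ⟨hy, he⟩ μ hμ
      rw [← he μ hμ]
      exact hfl hy hμ
    · intro y hy μ hμ k hk
      obtain ⟨h1, h2⟩ := hy μ hμ
      rw [hk] at h1 h2
      have h1' : ⌊inner ℝ μ x⌋ < k := by exact_mod_cast h1
      have h2' : k < ⌊inner ℝ μ x⌋ + 1 := by exact_mod_cast h2
      lia

theorem IsDominant.of_forall_pos {b : P.Base} {y : V}
    (h : ∀ α ∈ simpleRoots b, 0 < inner ℝ α y) : IsDominant b y := fun α hα => (h α hα).le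

theorem inner_pos_of_forall_simpleRoots [P.IsRootSystem] {b : P.Base} {y μ : V}
    (h : ∀ α ∈ simpleRoots b, 0 < inner ℝ α y) (hμ : μ ∈ posRoots b) : 0 < inner ℝ μ y := by
  have key : μ = 0 ∨ 0 < inner ℝ μ y := by
    have hμ' := posRoots_subset_posCone hμ
    clear hμ
    induction hμ' using AddSubmonoid.closure_induction with
    | mem x hx => exact Or.inr (h x hx)
    | zero => simp
    | add x z _ _ hx hz =>
      rcases hx with rfl | hx <;> rcases hz with rfl | hz
      · simp
      · simpa using Or.inr hz
      · simpa using Or.inr hx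
      · right; rw [inner_add_left]; positivity
  exact key.resolve_left (ne_zero_of_mem_roots (posRoots_subset_roots b hμ))

theorem rootsAboveOne_subset_longPosRoots [Finite ι] [P.IsRootSystem] [P.IsCrystallographic]
    [P.IsReduced] [P.IsIrreducible] (hP : IsInvariantInner P) (h2 : HasTwoRootLengths P)
    {b : P.Base} {y : V} (hy : y ∈ shortSimplex b) : rootsAboveOne b y ⊆ longPosRoots b := by
  rintro γ ⟨hγ, h1⟩
  refine ⟨hγ, fun β hβ => ?_⟩
  by_contra! hlt
  have := inner_le_inner_shortDominantRoot hP h2 (posRoots_subset_roots b hγ) hβ hlt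
    (IsDominant.of_forall_pos hy.1)
  linarith [hy.2]

theorem shortDominantRoot_mem_posRoots [Finite ι] [P.IsRootSystem] [P.IsCrystallographic]
    (hP : IsInvariantInner P) (h2 : HasTwoRootLengths P) (b : P.Base) :
    shortDominantRoot b ∈ posRoots b :=
  have h := isShortDominantRoot_shortDominantRoot b hP h2
  IsDominant.mem_posRoots h.1 h.2.2

theorem shortDominantRoot_notMem_longPosRoots [Finite ι] [P.IsCrystallographic]
    (hP : IsInvariantInner P) (h2 : HasTwoRootLengths P) (b : P.Base) :
    shortDominantRoot b ∉ longPosRoots b := by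
  obtain ⟨-, ⟨β, hβ, hlt⟩, -⟩ := isShortDominantRoot_shortDominantRoot b hP h2
  exact fun h => (h.2 β hβ).not_gt hlt

/-- Two elements have values adding up to more than 2, whereas every root is at most 2(θ_s, y) < 2.
-/
theorem rootsAboveOne_mem_longAbelianIdeals [Finite ι] [P.IsRootSystem] [P.IsCrystallographic]
    [P.IsReduced] [P.IsIrreducible] (hP : IsInvariantInner P) (h2 : HasTwoRootLengths P)
    {b : P.Base} {y : V} (hy : y ∈ shortSimplex b) :
    rootsAboveOne b y ∈ longAbelianIdeals b := by
  refine ⟨⟨fun γ h => h.1, ?_, ?_⟩, rootsAboveOne_subset_longPosRoots hP h2 hy⟩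
  · rintro μ ⟨-, hμ⟩ ν ⟨-, hν⟩ hs
    have := inner_le_two_mul_inner_shortDominantRoot hP h2 hs (IsDominant.of_forall_pos hy.1)
    rw [inner_add_left] at this
    linarith [hy.2]
  · rintro γ ⟨hγ, h1⟩ ν hν hs
    have hp := inner_pos_of_forall_simpleRoots hy.1 hν
    refine ⟨mem_posRoots_iff.mpr ⟨hs, ?_⟩, ?_⟩
    · rw [inner_add_left]
      linarith [(mem_posRoots_iff.mp hγ).2, (mem_posRoots_iff.mp hν).2]
    · rw [inner_add_left]; linarith

/-- Reflecting a dominant point in the hyperplane `(γ, x) = 1` changes the sign of no positive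
affine root other than `δ - γ`, when `γ` is the only root of the ideal with value below `1`. -/
theorem affine_sign_reflection [Finite ι] [P.IsRootSystem] [P.IsCrystallographic]
    (hP : IsInvariantInner P) {b : P.Base} {I : Set V} (hI : I ∈ longAbelianIdeals b) {γ : V}
    (hγ : γ ∈ I) {y : V} (hy : y ∈ hyperplaneComplement b)
    (hpos : ∀ α ∈ simpleRoots b, 0 < inner ℝ α y) (hyI : rootsAboveOne b y = I \ {γ})
    {μ : V} (hμ : μ ∈ roots P) {k : ℤ} (hne : ¬ (μ = -γ ∧ k = 1))
    (h : 0 < inner ℝ μ y + k) :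
    0 < inner ℝ μ (y + (2 * (1 - inner ℝ γ y) / inner ℝ γ γ) • γ) + k := by
  obtain ⟨⟨hsub, hab, hup⟩, hlong⟩ := hI
  have hγr := posRoots_subset_roots b (hsub hγ)
  have hγγ : 0 < inner ℝ γ γ := real_inner_self_pos.mpr (ne_zero_of_mem_roots hγr)
  have hγ0 := inner_pos_of_forall_simpleRoots hpos (hsub hγ)
  have hγ1 : inner ℝ γ y < 1 := by
    by_contra! h1
    have : γ ∈ rootsAboveOne b y :=
      ⟨hsub hγ, lt_of_le_of_ne h1 (by simpa using (hy γ (hsub hγ) 1).symm)⟩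
    rw [hyI] at this
    exact this.2 rfl
  have hval {ν : V} (hν : ν ∈ roots P) (k : ℤ) : inner ℝ ν y + k ≠ 0 := by
    intro h0
    rcases mem_posRoots_or_neg_mem b hν with hp | hp
    · exact hy ν hp (-k) (by push_cast; linarith)
    · exact hy _ hp k (by rw [inner_neg_left]; linarith)
  have hI' {ν : V} (hν : ν ∈ I) (hνγ : ν ≠ γ) : 1 < inner ℝ ν y := by
    have : ν ∈ rootsAboveOne b y := by rw [hyI]; exact ⟨hν, hνγ⟩
    exact this.2
  obtain ⟨n, hn, hs⟩ := exists_int_pairing hP hμ hγr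
  -- The value of an affine root at the reflected point is the value of the reflected affine root at
  -- y.
  have hform : inner ℝ μ (y + (2 * (1 - inner ℝ γ y) / inner ℝ γ γ) • γ) + k =
      inner ℝ (μ - (n : ℝ) • γ) y + ((k + n : ℤ) : ℝ) := by
    rw [inner_add_right, real_inner_smul_right, inner_sub_left, real_inner_smul_left]
    have : 2 * (1 - inner ℝ γ y) / inner ℝ γ γ * inner ℝ μ γ = n * (1 - inner ℝ γ y) := by
      field_simp
      linear_combination (1 - inner ℝ γ y) * hn
    rw [this]
    push_cast
    ring
  rw [hform]
  by_contra! hle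
  -- two affine roots that are positive at `y` and add up to `δ - γ` cannot exist
  have indec {μ ν : V} (hμ : μ ∈ roots P) (hν : ν ∈ roots P) (hsum : μ + ν = γ) {m : ℤ}
      (hm : 1 ≤ m) (h1 : inner ℝ μ y < m) (h2 : inner ℝ ν y < 1 - m) : False := by
    have hm' : (1 : ℝ) ≤ m := by exact_mod_cast hm
    -- As (ν, y) < 1 − m ≤ 0, ν is negative, so μ = γ + (−ν) is in I. Then (μ, y) > 1 forces m ≥ 2,
    -- hence (−ν, y) > 1 and −ν is in I; but γ + (−ν) is a root.
    have hν' : -ν ∈ posRoots b := by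
      refine (mem_posRoots_or_neg_mem b hν).resolve_left fun hp => ?_
      have := inner_pos_of_forall_simpleRoots hpos hp
      linarith
    have hμν : μ = γ + -ν := by rw [← hsum]; abel
    have hμI : μ ∈ I := hμν ▸ hup γ hγ _ hν' (hμν ▸ hμ)
    have hμγ : μ ≠ γ := fun h => ne_zero_of_mem_roots hν (by simpa [h] using hsum)
    have h3 := hI' hμI hμγ
    have hm2 : 1 < m := by
      have : (1 : ℝ) < m := h3.trans h1
      exact_mod_cast this
    have hm2' : (2 : ℝ) ≤ m := by exact_mod_cast hm2
    have hνI : -ν ∈ I := by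
      have : -ν ∈ rootsAboveOne b y := ⟨hν', by rw [inner_neg_left]; linarith⟩
      rw [hyI] at this
      exact this.1
    exact hab γ hγ _ hνI (hμν ▸ hμ)
  -- The reflected value is (γ, y) + k − 2, so its failing to be positive leaves only the excluded k
  -- = 1.
  by_cases hpar : μ = -γ
  · have hn2 : (n : ℝ) = -2 := by
      rw [hpar, inner_neg_left] at hn
      have : ((n : ℝ) + 2) * inner ℝ γ γ = 0 := by linarith
      have := (mul_eq_zero.mp this).resolve_right hγγ.ne'
      linarith
    rw [hpar, inner_neg_left] at h
    rw [hpar, inner_sub_left, inner_neg_left, real_inner_smul_left, Int.cast_add, hn2] at hle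
    have hk1 : (0 : ℝ) < k := by linarith
    have hk2 : (k : ℝ) < 2 := by linarith
    have hk1' : 0 < k := by exact_mod_cast hk1
    have hk2' : k < 2 := by exact_mod_cast hk2
    exact hne ⟨hpar, by lia⟩
  -- This is where the length of γ matters: a root not parallel to a long root pairs with it to −1,
  -- 0 or 1.
  have hn2 : -2 < n := by
    have := pairing_lt_two (μ := -μ) (γ := γ) (fun h => hpar (by rw [← h, neg_neg]))
      (by rw [norm_neg]; exact (hlong hγ).2 μ hμ) (ne_zero_of_mem_roots hγr) (n := -n)
      (by rw [inner_neg_left]; push_cast; linarith)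
    lia
  have hn0 : n < 0 := by
    rw [inner_sub_left, real_inner_smul_left, Int.cast_add] at hle
    have : (n : ℝ) * (1 - inner ℝ γ y) < 0 := by linarith
    have : (n : ℝ) < 0 := by
      by_contra! h3
      have := mul_nonneg h3 (sub_pos.mpr hγ1).le
      linarith
    exact_mod_cast this
  obtain rfl : n = -1 := by lia
  have hlt := lt_of_le_of_ne hle (hval hs _)
  have hs' : μ - ((-1 : ℤ) : ℝ) • γ = μ + γ := by simp
  rw [hs'] at hlt hs
  push_cast at hlt
  -- For a = μ + kδ the reflection is s(a) = a − (δ − γ), so a and −s(a) are positive at y with sum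
  -- δ − γ. One of their δ-coefficients k and 1 − k is at least 1.
  rcases le_or_gt 1 k with hk | hk
  · refine indec (neg_mem_roots hμ) hs (by abel) hk ?_ ?_
    · rw [inner_neg_left]; linarith
    · linarith
  · refine indec hs (neg_mem_roots hμ) (by abel) (m := 1 - k) (by lia) ?_ ?_
    · push_cast; linarith
    · rw [inner_neg_left]; push_cast; linarith

/-- A small positive multiple of `coweight b` works, since heights are bounded. -/
theorem exists_forall_posRoots_lt_one [Finite ι] [P.IsRootSystem] (b : P.Base) :
    ∃ y : V, ∀ μ ∈ posRoots b, 0 < inner ℝ μ y ∧ inner ℝ μ y < 1 := by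
  obtain ⟨M, hM⟩ := ((finite_roots (P := P)).image
    fun μ => inner ℝ μ (coweight b)).bddAbove
  have hM0 : 0 < |M| + 1 := by positivity
  refine ⟨(|M| + 1)⁻¹ • coweight b, fun μ hμ => ?_⟩
  have h1 := mem_posRoots_iff.mp hμ
  have h2 : inner ℝ μ (coweight b) ≤ M := hM (mem_image_of_mem _ h1.1)
  rw [real_inner_smul_right]
  refine ⟨mul_pos (inv_pos.mpr hM0) h1.2, ?_⟩
  rw [inv_mul_lt_one₀ hM0]
  linarith [le_abs_self M]

theorem mem_hyperplaneComplement_of_forall {b : P.Base} {y : V}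
    (h : ∀ μ ∈ posRoots b, 0 < inner ℝ μ y ∧ inner ℝ μ y < 1) : y ∈ hyperplaneComplement b := by
  intro μ hμ k hk
  obtain ⟨h1, h2⟩ := h μ hμ
  rw [hk] at h1 h2
  have h1' : 0 < k := by exact_mod_cast h1
  have h2' : k < 1 := by exact_mod_cast h2
  lia

/-- Removing an element of minimal height from a long Abelian ideal leaves such an ideal. -/
theorem sdiff_singleton_mem_longAbelianIdeals [P.IsRootSystem] {b : P.Base} {I : Set V}
    (hI : I ∈ longAbelianIdeals b) {γ : V}
    (hmin : ∀ β ∈ I, inner ℝ γ (coweight b) ≤ inner ℝ β (coweight b)) :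
    I \ {γ} ∈ longAbelianIdeals b := by
  obtain ⟨⟨hsub, hab, hup⟩, hlong⟩ := hI
  refine ⟨⟨sdiff_subset.trans hsub, fun μ hμ ν hν => hab μ hμ.1 ν hν.1, ?_⟩,
    sdiff_subset.trans hlong⟩
  intro β hβ ν hν hs
  refine ⟨hup β hβ.1 ν hν hs, fun heq => ?_⟩
  have h1 := hmin β hβ.1
  rw [mem_singleton_iff] at heq
  rw [← heq, inner_add_left] at h1
  linarith [(mem_posRoots_iff.mp hν).2]

/-- Every long Abelian ideal is cut out by a generic point of the dominant chamber. -/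
theorem exists_rootsAboveOne_eq [Finite ι] [P.IsRootSystem] [P.IsCrystallographic]
    (hP : IsInvariantInner P) {b : P.Base} {I : Set V} (hI : I ∈ longAbelianIdeals b) :
    ∃ y ∈ hyperplaneComplement b, (∀ α ∈ simpleRoots b, 0 < inner ℝ α y) ∧
      rootsAboveOne b y = I := by
  have hfin : I.Finite := finite_roots.subset (hI.1.subset_posRoots.trans (posRoots_subset_roots b))
  induction hn : I.ncard generalizing I with
  | zero =>
    obtain rfl := (ncard_eq_zero hfin).mp hn
    obtain ⟨y, hy⟩ := exists_forall_posRoots_lt_one b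
    refine ⟨y, mem_hyperplaneComplement_of_forall hy,
      fun α hα => (hy α (simpleRoots_subset_posRoots b hα)).1, ?_⟩
    exact eq_empty_of_forall_notMem fun γ h => (hy γ h.1).2.not_gt h.2
  | succ n ih =>
    have hne : I.Nonempty := (ncard_pos hfin).mp (by lia)
    obtain ⟨γ, hγ, hmin⟩ := exists_min_image I (fun v => inner ℝ v (coweight b)) hfin hne
    obtain ⟨y, hy, hpos, hyI⟩ := ih (sdiff_singleton_mem_longAbelianIdeals hI hmin) hfin.sdiff
      (by rw [ncard_sdiff_singleton_of_mem hγ]; lia)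
    have hsub := hI.1.subset_posRoots
    have key {μ : V} (hμ : μ ∈ roots P) {k : ℤ} :=
      affine_sign_reflection hP hI hγ hy hpos hyI hμ (k := k)
    -- The reflection of y in the hyperplane (γ, x) = 1.
    set z := y + (2 * (1 - inner ℝ γ y) / inner ℝ γ γ) • γ with hz
    have hγr := posRoots_subset_roots b (hsub hγ)
    have hγγ : 0 < inner ℝ γ γ := real_inner_self_pos.mpr (ne_zero_of_mem_roots hγr)
    have hγ1 : inner ℝ γ y < 1 := by
      by_contra! h1
      have : γ ∈ rootsAboveOne b y :=
        ⟨hsub hγ, lt_of_le_of_ne h1 (by simpa using (hy γ (hsub hγ) 1).symm)⟩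
      rw [hyI] at this
      exact this.2 rfl
    have hγz : inner ℝ γ z = 2 - inner ℝ γ y := by
      rw [hz, inner_add_right, real_inner_smul_right]
      field_simp
      ring
    have hγpos := inner_pos_of_forall_simpleRoots hpos (hsub hγ)
    have hneg {μ : V} (hμ : μ ∈ posRoots b) : μ ≠ -γ := fun h => by
      have := inner_pos_of_forall_simpleRoots hpos hμ
      rw [h, inner_neg_left] at this
      linarith
    have hlt {μ : V} (hμ : μ ∈ posRoots b) (k : ℤ) (h : (k : ℝ) < inner ℝ μ y) :
        (k : ℝ) < inner ℝ μ z := by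
      have := key (posRoots_subset_roots b hμ) (k := -k) (fun h => hneg hμ h.1)
        (by push_cast; linarith)
      push_cast at this
      linarith
    -- An upper bound k on μ is positivity of kδ − μ; the only one lost belongs to δ − γ.
    have hgt {μ : V} (hμ : μ ∈ posRoots b) (k : ℤ) (hne : ¬ (μ = γ ∧ k = 1))
        (h : inner ℝ μ y < k) : inner ℝ μ z < k := by
      have := key (neg_mem_roots (posRoots_subset_roots b hμ)) (k := k)
        (fun h => hne ⟨neg_injective h.1, h.2⟩) (by rw [inner_neg_left]; linarith)
      rw [inner_neg_left] at this
      linarith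
    refine ⟨z, fun μ hμ k hk => ?_, fun α hα => ?_, ?_⟩
    · by_cases hc : μ = γ ∧ k = 1
      · rw [hc.1, hc.2, hγz] at hk
        push_cast at hk
        linarith
      · rcases lt_or_gt_of_ne (hy μ hμ k) with h | h
        · exact (hgt hμ k hc h).ne hk
        · exact (hlt hμ k h).ne' hk
    · have := hlt (simpleRoots_subset_posRoots b hα) 0 (by simpa using hpos α hα)
      simpa using this
    · ext μ
      by_cases hμγ : μ = γ
      · subst hμγ
        refine ⟨fun _ => hγ, fun _ => ⟨hsub hγ, by rw [hγz]; linarith⟩⟩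
      · constructor
        · rintro ⟨hμ, h1⟩
          have : μ ∈ rootsAboveOne b y := by
            refine ⟨hμ, ?_⟩
            by_contra! hle
            have := hgt hμ 1 (fun h => hμγ h.1)
              (lt_of_le_of_ne (by simpa using hle) (hy μ hμ 1))
            push_cast at this
            linarith
          rw [hyI] at this
          exact this.1
        · intro hμ
          have : μ ∈ rootsAboveOne b y := by rw [hyI]; exact ⟨hμ, hμγ⟩
          have := hlt this.1 1 (by simpa using this.2)
          exact ⟨hsub hμ, by simpa using this⟩

/-- The set of positive roots whose values on `C` exceed `1`. -/
def rootsAboveOneOn (b : P.Base) (C : Set V) : Set V :=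
  {γ | γ ∈ posRoots b ∧ ∃ y ∈ C, 1 < inner ℝ γ y}

theorem rootsAboveOneOn_connectedComponentIn {b : P.Base} {x : V}
    (hx : x ∈ hyperplaneComplement b) :
    rootsAboveOneOn b (connectedComponentIn (hyperplaneComplement b) x) = rootsAboveOne b x := by
  ext γ
  refine and_congr_right fun hγ => ⟨?_, fun h => ⟨x, mem_connectedComponentIn hx, h⟩⟩
  rintro ⟨y, hy, h1⟩
  rw [connectedComponentIn_hyperplaneComplement hx] at hy
  have h2 : (1 : ℤ) ≤ ⌊inner ℝ γ y⌋ := Int.le_floor.mpr (by simpa using h1.le)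
  rw [hy.2 γ hγ] at h2
  have h3 : (1 : ℝ) ≤ inner ℝ γ x := by simpa using Int.le_floor.mp h2
  exact lt_of_le_of_ne h3 (by simpa using (hx γ hγ 1).symm)

theorem floor_inner_eq [Finite ι] [P.IsRootSystem] [P.IsCrystallographic]
    [P.IsReduced] [P.IsIrreducible] (hP : IsInvariantInner P) (h2 : HasTwoRootLengths P)
    {b : P.Base} {y : V} (hy : y ∈ hyperplaneComplement b) (hys : y ∈ shortSimplex b) {μ : V}
    (hμ : μ ∈ posRoots b) [Decidable (μ ∈ rootsAboveOne b y)] :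
    ⌊inner ℝ μ y⌋ = if μ ∈ rootsAboveOne b y then 1 else 0 := by
  have h0 := inner_pos_of_forall_simpleRoots hys.1 hμ
  have hle := inner_le_two_mul_inner_shortDominantRoot hP h2 (posRoots_subset_roots b hμ)
    (IsDominant.of_forall_pos hys.1)
  have hlt := hys.2
  split_ifs with h
  · rw [Int.floor_eq_iff]
    exact ⟨by simpa using h.2.le, by push_cast; linarith⟩
  · rw [Int.floor_eq_iff]
    refine ⟨by simpa using h0.le, ?_⟩
    have : ¬ 1 < inner ℝ μ y := fun h1 => h ⟨hμ, h1⟩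
    have := lt_of_le_of_ne (not_lt.mp this) (by simpa using hy μ hμ 1)
    simpa using this

theorem bijOn_rootsAboveOneOn [Finite ι] [P.IsRootSystem] [P.IsCrystallographic]
    [P.IsReduced] [P.IsIrreducible] (hP : IsInvariantInner P) (h2 : HasTwoRootLengths P)
    (b : P.Base) :
    BijOn (rootsAboveOneOn b) {C | C ∈ alcoves b ∧ C ⊆ shortSimplex b}
      (longAbelianIdeals b) := by
  classical
  refine ⟨?_, ?_, ?_⟩
  · rintro _ ⟨⟨x, hx, rfl⟩, hC⟩
    rw [rootsAboveOneOn_connectedComponentIn hx]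
    exact rootsAboveOne_mem_longAbelianIdeals hP h2 (hC (mem_connectedComponentIn hx))
  · rintro _ ⟨⟨x, hx, rfl⟩, hC⟩ _ ⟨⟨y, hy, rfl⟩, hD⟩ heq
    rw [rootsAboveOneOn_connectedComponentIn hx, rootsAboveOneOn_connectedComponentIn hy] at heq
    apply connectedComponentIn_eq
    rw [connectedComponentIn_hyperplaneComplement hx]
    refine ⟨hy, fun μ hμ => ?_⟩
    rw [floor_inner_eq hP h2 hx (hC (mem_connectedComponentIn hx)) hμ,
      floor_inner_eq hP h2 hy (hD (mem_connectedComponentIn hy)) hμ]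
    simp only [heq]
  · intro I hI
    obtain ⟨y, hy, hpos, hyI⟩ := exists_rootsAboveOne_eq hP hI
    refine ⟨_, ⟨⟨y, hy, rfl⟩, ?_⟩, by rw [rootsAboveOneOn_connectedComponentIn hy, hyI]⟩
    have hσ := shortDominantRoot_mem_posRoots hP h2 b
    rw [connectedComponentIn_hyperplaneComplement hy]
    rintro z ⟨hz, hfl⟩
    refine ⟨fun α hα => ?_, ?_⟩
    · have hα' := simpleRoots_subset_posRoots b hα
      have h1 : (0 : ℤ) ≤ ⌊inner ℝ α z⌋ := by
        rw [hfl α hα']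
        exact Int.le_floor.mpr (by simpa using (hpos α hα).le)
      have h3 : (0 : ℝ) ≤ inner ℝ α z := by simpa using Int.le_floor.mp h1
      exact lt_of_le_of_ne h3 (by simpa using (hz α hα' 0).symm)
    -- A long ideal omits θ_s, so θ_s is below 1 at y; equality of floors carries this to the whole
    -- alcove.
    · have h1 : ¬ 1 < inner ℝ (shortDominantRoot b) y := fun h =>
        shortDominantRoot_notMem_longPosRoots hP h2 b (hI.2 (hyI ▸ ⟨hσ, h⟩))
      have h3 : inner ℝ (shortDominantRoot b) y < (1 : ℤ) :=
        lt_of_le_of_ne (by simpa using h1) (hy _ hσ 1)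
      rw [← Int.floor_lt, ← hfl _ hσ, Int.floor_lt] at h3
      simpa using h3

theorem finite_longAbelianIdeals [Finite ι] (b : P.Base) : (longAbelianIdeals b).Finite :=
  (finite_roots (P := P)).finite_subsets.subset fun _ hI =>
    hI.1.subset_posRoots.trans (posRoots_subset_roots b)

end Alcoves

/-! ### The affine Weyl group and minuscule elements -/

section Affine

variable {ι V N : Type*} [NormedAddCommGroup V] [InnerProductSpace ℝ V]
  [AddCommGroup N] [Module ℝ N] {P : RootPairing ι ℝ V N}

theorem affineForm_add_left (u u' v : AffineSpan V) :
    affineForm (u + u') v = affineForm u v + affineForm u' v := by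
  simp only [affineForm, Prod.fst_add, Prod.snd_add, inner_add_left]; ring

theorem affineForm_smul_left (c : ℝ) (u v : AffineSpan V) :
    affineForm (c • u) v = c * affineForm u v := by
  simp only [affineForm, Prod.smul_fst, Prod.smul_snd, real_inner_smul_left, smul_eq_mul]; ring

theorem affineForm_comm (u v : AffineSpan V) : affineForm u v = affineForm v u := by
  simp only [affineForm, real_inner_comm u.1]; ring

theorem affineForm_affineRoot (μ ν : V) (k l : ℤ) :
    affineForm (affineRoot μ k) (affineRoot ν l) = inner ℝ μ ν := by
  simp [affineForm, affineRoot]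

theorem IsReflectionAt.affineForm_apply {a : AffineSpan V} {g : AffineSpan V ≃ₗ[ℝ] AffineSpan V}
    (hg : IsReflectionAt a g) (ha : affineForm a a ≠ 0) (u v : AffineSpan V) :
    affineForm (g u) (g v) = affineForm u v := by
  have hsub (c d : ℝ) : affineForm (u - c • a) (v - d • a) = affineForm u v - d * affineForm u a
      - c * affineForm v a + c * d * affineForm a a := by
    have h1 : u - c • a = u + (-c) • a := by module
    have h2 : v - d • a = v + (-d) • a := by module
    rw [h1, h2, affineForm_add_left, affineForm_smul_left, affineForm_comm u, affineForm_comm a,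
      affineForm_add_left, affineForm_add_left, affineForm_smul_left, affineForm_smul_left,
      affineForm_comm v u, affineForm_comm a u]
    ring
  rw [hg u, hg v, hsub]
  field_simp
  ring

theorem IsReflectionAt.apply_apply {a : AffineSpan V} {g : AffineSpan V ≃ₗ[ℝ] AffineSpan V}
    (hg : IsReflectionAt a g) (ha : affineForm a a ≠ 0) (v : AffineSpan V) : g (g v) = v := by
  have h : affineForm (g v) a = -affineForm v a := by
    rw [hg v, sub_eq_add_neg, ← neg_smul, affineForm_add_left, affineForm_smul_left]
    field_simp
    ring
  rw [hg (g v), h, hg v]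
  module

/-- The affine real roots. -/
def affineRoots (P : RootPairing ι ℝ V N) : Set (AffineSpan V) :=
  {a | ∃ μ ∈ roots P, ∃ k : ℤ, a = affineRoot μ k}

theorem exists_eq_affineRoot_of_mem_simpleAffineRoots [Finite ι] [Nonempty ι] {b : P.Base}
    {a : AffineSpan V} (ha : a ∈ simpleAffineRoots b) : a ∈ affineRoots P := by
  rcases ha with rfl | ⟨α, hα, rfl⟩
  · exact ⟨_, neg_mem_roots (highestRoot_mem_roots b), 1, rfl⟩
  · exact ⟨α, simpleRoots_subset_roots b hα, 0, rfl⟩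

theorem IsReflectionAt.apply_mem_affineRoots [P.IsCrystallographic] (hP : IsInvariantInner P)
    {a c : AffineSpan V} (ha : a ∈ affineRoots P) {g : AffineSpan V ≃ₗ[ℝ] AffineSpan V}
    (hg : IsReflectionAt a g) (hc : c ∈ affineRoots P) : g c ∈ affineRoots P := by
  obtain ⟨μ, hμ, k, rfl⟩ := ha
  obtain ⟨ν, hν, l, rfl⟩ := hc
  obtain ⟨n, hn, hs⟩ := exists_int_pairing hP hν hμ
  refine ⟨ν - (n : ℝ) • μ, hs, l - n * k, ?_⟩
  have hμμ : 0 < inner ℝ μ μ := real_inner_self_pos.mpr (ne_zero_of_mem_roots hμ)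
  rw [hg, affineForm_affineRoot, affineForm_affineRoot, hn, mul_div_cancel_right₀ _ hμμ.ne']
  simp [affineRoot]

theorem affineForm_self_ne_zero {a : AffineSpan V} (ha : a ∈ affineRoots P) :
    affineForm a a ≠ 0 := by
  obtain ⟨μ, hμ, k, rfl⟩ := ha
  rw [affineForm_affineRoot]
  exact (real_inner_self_pos.mpr (ne_zero_of_mem_roots hμ)).ne'

variable {b : P.Base}

theorem mem_posAffineRoots_or_neg_mem [P.IsRootSystem] {a : AffineSpan V}
    (ha : a ∈ affineRoots P) : a ∈ posAffineRoots b ∨ -a ∈ posAffineRoots b := by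
  obtain ⟨μ, hμ, k, rfl⟩ := ha
  rw [show -affineRoot μ k = affineRoot (-μ) (-k) by simp [affineRoot]]
  rcases lt_trichotomy k 0 with hk | rfl | hk
  · exact Or.inr (Or.inr ⟨_, neg_mem_roots hμ, -k, by lia, rfl⟩)
  · rcases mem_posRoots_or_neg_mem b hμ with h | h
    · exact Or.inl (Or.inl ⟨μ, h, rfl⟩)
    · exact Or.inr (Or.inl ⟨_, h, by rw [neg_zero]⟩)
  · exact Or.inl (Or.inr ⟨μ, hμ, k, hk, rfl⟩)

theorem posAffineRoots_subset_affineRoots : posAffineRoots b ⊆ affineRoots P := by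
  rintro _ (⟨μ, hμ, rfl⟩ | ⟨μ, hμ, k, -, rfl⟩)
  · exact ⟨μ, posRoots_subset_roots b hμ, 0, rfl⟩
  · exact ⟨μ, hμ, k, rfl⟩

variable [Finite ι]

/-- Since μ ≥ −θ for every root μ, the value of μ + kδ with k ≥ 1 is at least 1 − (θ, x) > 0. -/
theorem affineForm_pos_of_mem_posAffineRoots [P.IsRootSystem] [P.IsCrystallographic]
    [P.IsReduced] [P.IsIrreducible] (hP : IsInvariantInner P) {x : V}
    (hx : x ∈ fundamentalAlcove b) {a : AffineSpan V} (ha : a ∈ posAffineRoots b) :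
    0 < affineForm a (x, 0, 1) := by
  rcases ha with ⟨μ, hμ, rfl⟩ | ⟨μ, hμ, k, hk, rfl⟩
  · simpa [affineForm, affineRoot] using inner_pos_of_forall_simpleRoots hx.1 hμ
  · have h1 := (IsDominant.of_forall_pos hx.1).inner_nonneg
      (highestRoot_sub_mem_posCone hP b (neg_mem_roots hμ))
    rw [inner_sub_left, inner_neg_left] at h1
    have h2 := hx.2
    have h3 : (1 : ℝ) ≤ k := by exact_mod_cast hk
    have : 0 < inner ℝ μ x + k := by linarith
    simpa [affineForm, affineRoot] using this

variable [Nonempty ι]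

theorem affineForm_affineWeylGroup (w : affineWeylGroup b) (u v : AffineSpan V) :
    affineForm (w.1 u) (w.1 v) = affineForm u v := by
  obtain ⟨w, hw⟩ := w
  change affineForm (w u) (w v) = affineForm u v
  induction hw using Subgroup.closure_induction generalizing u v with
  | mem g hg =>
    obtain ⟨a, ha, hg⟩ := hg
    exact hg.affineForm_apply
      (affineForm_self_ne_zero (exists_eq_affineRoot_of_mem_simpleAffineRoots ha)) u v
  | one => rfl
  | mul g h _ _ hg hh => exact (hg _ _).trans (hh u v)
  | inv g _ hg =>
    have hinv (x : AffineSpan V) : g (g⁻¹ x) = x := g.apply_symm_apply x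
    rw [← hg, hinv, hinv]

theorem affineWeylGroup_apply_mem_affineRoots [P.IsCrystallographic] (hP : IsInvariantInner P)
    (w : affineWeylGroup b) {c : AffineSpan V} (hc : c ∈ affineRoots P) :
    w.1 c ∈ affineRoots P := by
  obtain ⟨w, hw⟩ := w
  change w c ∈ affineRoots P
  -- An equivalence passes to inverses in the induction.
  suffices ∀ c, c ∈ affineRoots P ↔ w c ∈ affineRoots P from (this c).mp hc
  clear hc c
  induction hw using Subgroup.closure_induction with
  | mem g hg =>
    obtain ⟨a, ha, hg⟩ := hg
    have ha' := exists_eq_affineRoot_of_mem_simpleAffineRoots ha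
    refine fun c => ⟨hg.apply_mem_affineRoots hP ha', fun h => ?_⟩
    rw [← hg.apply_apply (affineForm_self_ne_zero ha') c]
    exact hg.apply_mem_affineRoots hP ha' h
  | one => exact fun c => Iff.rfl
  | mul g h _ _ hg hh => exact fun c => (hh c).trans (hg _)
  | inv g _ hg =>
    intro c
    have hinv : g (g⁻¹ c) = c := g.apply_symm_apply c
    rw [hg (g⁻¹ c), hinv]

/-- The last coordinate is the pairing with δ, which is orthogonal to all affine roots. -/
theorem affineWeylGroup_apply_snd_snd (w : affineWeylGroup b) (v : AffineSpan V) :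
    (w.1 v).2.2 = v.2.2 := by
  obtain ⟨w, hw⟩ := w
  change (w v).2.2 = v.2.2
  induction hw using Subgroup.closure_induction generalizing v with
  | mem g hg =>
    obtain ⟨a, ha, hg⟩ := hg
    obtain ⟨μ, -, k, rfl⟩ := exists_eq_affineRoot_of_mem_simpleAffineRoots ha
    rw [hg]
    simp [affineRoot]
  | one => rfl
  | mul g h _ _ hg hh => exact (hg _).trans (hh v)
  | inv g _ hg =>
    have hinv : g (g⁻¹ v) = v := g.apply_symm_apply v
    rw [← hg, hinv]

/-- The value of an affine root at `w⁻¹ · x` is the value of its image under `w` at `x`. -/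
theorem inner_dot_inv (w : affineWeylGroup b) (μ : V) (k : ℤ) (x : V) :
    inner ℝ μ (dot w⁻¹ x) + k = affineForm (w.1 (affineRoot μ k)) (x, 0, 1) := by
  have hinv : w.1 (w⁻¹.1 (x, 0, 1)) = (x, 0, 1) := w.1.apply_symm_apply _
  have h1 := affineForm_affineWeylGroup w (affineRoot μ k) (w⁻¹.1 (x, 0, 1))
  have h2 := affineWeylGroup_apply_snd_snd w⁻¹ (x, 0, 1)
  rw [hinv] at h1
  rw [h1]
  simp only [affineForm, affineRoot, dot, h2, mul_one, zero_mul, add_zero]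

theorem mem_inversionSet_iff [P.IsRootSystem] [P.IsCrystallographic]
    [P.IsReduced] [P.IsIrreducible] (hP : IsInvariantInner P) (w : affineWeylGroup b) {x : V}
    (hx : x ∈ fundamentalAlcove b) {μ : V} {k : ℤ} (ha : affineRoot μ k ∈ posAffineRoots b) :
    affineRoot μ k ∈ inversionSet w ↔ inner ℝ μ (dot w⁻¹ x) + k < 0 := by
  rw [inner_dot_inv]
  have hneg (a : AffineSpan V) : affineForm (-a) (x, 0, 1) = -affineForm a (x, 0, 1) := by
    rw [← neg_one_smul ℝ, affineForm_smul_left, neg_one_mul]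
  constructor
  · rintro ⟨-, h⟩
    have := affineForm_pos_of_mem_posAffineRoots hP hx h
    rw [hneg] at this
    linarith
  · intro h
    refine ⟨ha, ?_⟩
    refine (mem_posAffineRoots_or_neg_mem (affineWeylGroup_apply_mem_affineRoots hP w
      (posAffineRoots_subset_affineRoots ha))).resolve_left fun hp => ?_
    have := affineForm_pos_of_mem_posAffineRoots hP hx hp
    linarith

/-- Points of w⁻¹·𝒜 lie on no affine hyperplane, so weak inequalities there become strict. -/
theorem affineWeylGroup_inner_ne_zero [P.IsRootSystem] [P.IsCrystallographic]
    [P.IsReduced] [P.IsIrreducible] (hP : IsInvariantInner P) (w : affineWeylGroup b) {x : V}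
    (hx : x ∈ fundamentalAlcove b) {μ : V} (hμ : μ ∈ roots P) (k : ℤ) :
    inner ℝ μ (dot w⁻¹ x) + k ≠ 0 := by
  rw [inner_dot_inv]
  have hneg (a : AffineSpan V) : affineForm (-a) (x, 0, 1) = -affineForm a (x, 0, 1) := by
    rw [← neg_one_smul ℝ, affineForm_smul_left, neg_one_mul]
  rcases mem_posAffineRoots_or_neg_mem (b := b)
    (affineWeylGroup_apply_mem_affineRoots hP w ⟨μ, hμ, k, rfl⟩) with h | h
  · exact (affineForm_pos_of_mem_posAffineRoots hP hx h).ne'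
  · have := affineForm_pos_of_mem_posAffineRoots hP hx h
    rw [hneg] at this
    linarith

theorem idealOf_eq_rootsAboveOne [P.IsRootSystem] [P.IsCrystallographic]
    [P.IsReduced] [P.IsIrreducible] (hP : IsInvariantInner P) (w : affineWeylGroup b) {x : V}
    (hx : x ∈ fundamentalAlcove b) : idealOf w = rootsAboveOne b (dot w⁻¹ x) := by
  ext γ
  refine and_congr_right fun hγ => ?_
  rw [mem_inversionSet_iff hP w hx
    (Or.inr ⟨_, neg_mem_roots (posRoots_subset_roots b hγ), 1, le_rfl, rfl⟩), inner_neg_left]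
  push_cast
  constructor <;> intro h <;> linarith

/-- Inversions of a minuscule element have δ-coefficient 1, so no element of Π is inverted. -/
theorem IsMinuscule.inner_pos [P.IsRootSystem] [P.IsCrystallographic]
    [P.IsReduced] [P.IsIrreducible] (hP : IsInvariantInner P) {w : affineWeylGroup b}
    (hw : IsMinuscule w) {x : V} (hx : x ∈ fundamentalAlcove b) {α : V}
    (hα : α ∈ simpleRoots b) : 0 < inner ℝ α (dot w⁻¹ x) := by
  have hα' := simpleRoots_subset_posRoots b hα
  have hnot : affineRoot α 0 ∉ inversionSet w := by
    obtain ⟨I, -, hI⟩ := hw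
    rw [hI]
    rintro ⟨γ, -, h⟩
    have := congrArg (fun v : AffineSpan V => v.2.1) h
    simp [affineRoot] at this
  rw [mem_inversionSet_iff hP w hx (Or.inl ⟨α, hα', rfl⟩)] at hnot
  have hne := affineWeylGroup_inner_ne_zero hP w hx (posRoots_subset_roots b hα') 0
  have := lt_of_le_of_ne (not_lt.mp hnot) hne.symm
  simpa using this

theorem fundamentalAlcove_nonempty [P.IsRootSystem] (b : P.Base) :
    (fundamentalAlcove b).Nonempty := by
  obtain ⟨y, hy⟩ := exists_forall_posRoots_lt_one b
  have hpos : ∀ α ∈ simpleRoots b, 0 < inner ℝ α y := fun α hα =>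
    (hy α (simpleRoots_subset_posRoots b hα)).1
  have hθ := highestRoot_mem_roots b
  refine ⟨y, hpos, ?_⟩
  rcases mem_posRoots_or_neg_mem b hθ with h | h
  · exact (hy _ h).2
  · have := (hy _ h).1
    rw [inner_neg_left] at this
    linarith

theorem idealOf_subset_longPosRoots_iff [P.IsRootSystem] [P.IsCrystallographic]
    [P.IsReduced] [P.IsIrreducible] (hP : IsInvariantInner P) (h2 : HasTwoRootLengths P)
    {w : affineWeylGroup b} (hw : IsMinuscule w) :
    idealOf w ⊆ longPosRoots b ↔ dot w⁻¹ '' fundamentalAlcove b ⊆ shortSimplex b := by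
  constructor
  · rintro hI _ ⟨x, hx, rfl⟩
    refine ⟨fun α hα => hw.inner_pos hP hx hα, ?_⟩
    have hσ := shortDominantRoot_mem_posRoots hP h2 b
    have hle : ¬ 1 < inner ℝ (shortDominantRoot b) (dot w⁻¹ x) := fun h => by
      rw [idealOf_eq_rootsAboveOne hP w hx] at hI
      exact shortDominantRoot_notMem_longPosRoots hP h2 b (hI ⟨hσ, h⟩)
    have hne := affineWeylGroup_inner_ne_zero hP w hx (posRoots_subset_roots b hσ) (-1)
    refine lt_of_le_of_ne (not_lt.mp hle) fun h => hne ?_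
    rw [h]; simp
  · intro h
    obtain ⟨x, hx⟩ := fundamentalAlcove_nonempty b
    rw [idealOf_eq_rootsAboveOne hP w hx]
    exact rootsAboveOne_subset_longPosRoots hP h2 (h (mem_image_of_mem _ hx))

theorem idealOf_mem_longAbelianIdeals_iff [P.IsRootSystem] [P.IsCrystallographic]
    [P.IsReduced] [P.IsIrreducible] (hP : IsInvariantInner P) (h2 : HasTwoRootLengths P)
    {w : affineWeylGroup b} (hw : IsMinuscule w) :
    idealOf w ∈ longAbelianIdeals b ↔
      dot w⁻¹ '' fundamentalAlcove b ⊆ shortSimplex b := by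
  refine ⟨fun h => (idealOf_subset_longPosRoots_iff hP h2 hw).mp h.2, fun h => ?_⟩
  obtain ⟨x, hx⟩ := fundamentalAlcove_nonempty b
  rw [idealOf_eq_rootsAboveOne hP w hx]
  exact rootsAboveOne_mem_longAbelianIdeals hP h2 (h (mem_image_of_mem _ hx))

end Affine

end LongAbelian

theorem mainTheorem3 {ι V N : Type*} [Finite ι]
    [NormedAddCommGroup V] [InnerProductSpace ℝ V] [AddCommGroup N] [Module ℝ N]
    (P : RootPairing ι ℝ V N) [P.IsRootSystem] [P.IsCrystallographic] [P.IsReduced]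
    [P.IsIrreducible] (hP : LongAbelian.IsInvariantInner P)
    (h2 : LongAbelian.HasTwoRootLengths P) (b : P.Base) :
    (∀ w : LongAbelian.affineWeylGroup b, LongAbelian.IsMinuscule w →
      (LongAbelian.idealOf w ∈ LongAbelian.longAbelianIdeals b ↔
        LongAbelian.dot w⁻¹ '' LongAbelian.fundamentalAlcove b ⊆ LongAbelian.shortSimplex b) ∧
      (LongAbelian.idealOf w ⊆ LongAbelian.longPosRoots b ↔
        LongAbelian.dot w⁻¹ '' LongAbelian.fundamentalAlcove b ⊆ LongAbelian.shortSimplex b)) ∧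
    (LongAbelian.longAbelianIdeals b).Finite ∧
    {C | C ∈ LongAbelian.alcoves b ∧ C ⊆ LongAbelian.shortSimplex b}.Finite ∧
    (LongAbelian.longAbelianIdeals b).ncard =
      {C | C ∈ LongAbelian.alcoves b ∧ C ⊆ LongAbelian.shortSimplex b}.ncard := by
  have : Nonempty ι := by
    obtain ⟨_, ⟨i, -⟩, -⟩ := h2
    exact ⟨i⟩
  have hbij := LongAbelian.bijOn_rootsAboveOneOn hP h2 b
  have hfin := LongAbelian.finite_longAbelianIdeals b
  refine ⟨fun w hw => ⟨LongAbelian.idealOf_mem_longAbelianIdeals_iff hP h2 hw,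
    LongAbelian.idealOf_subset_longPosRoots_iff hP h2 hw⟩, hfin,
    hbij.finite_iff_finite.mpr hfin, ?_⟩
  rw [← hbij.image_eq, hbij.injOn.ncard_image]
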